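/- Let $H\in(0,\tfrac12)$, $x_0,a,\sigma>0$ and $T>0$. Let $B^H=\{B^H(t),\,t\ge 0\}$ be a fractional Brownian motion with Hurst index $H$, i.e. a centered Gaussian process with $$\mathbb E[B^H(t)B^H(s)]=\tfrac12\left(t^{2H}+s^{2H}-|t-s|^{2H}\right),\qquad s,t\ge 0,$$ with almost surely continuous paths. For $\varepsilon>0$ let $X^H_\varepsilon$ be the pathwise continuous solution of $$X^H_\varepsilon(t)=x_0+\int_0^t\frac{a}{X^H_\varepsilon(s)\mathbf 1_{\{X^H_\varepsilon(s)>0\}}+\varepsilon}\,ds+\sigma B^H(t),\qquad t\ge 0,$$ and let $X^H(t):=\lim_{\varepsilon\downarrow 0}X^H_\varepsilon(t)$, $t\ge 0$, be the rough Bessel process. For $n\ge 1$ put $t_k=kT/n$, $0\le k\le n$, and $$V^n_{1,2}(X^H)=\sum_{k=0}^{n-1}\left(X^H(t_{k+1})-X^H(t_k)\right)^2,\qquad V^n_{2,2}(X^H)=\sum_{k=0}^{n-2}\left(X^H(t_{k+2})-2X^H(t_{k+1})+X^H(t_k)\right)^2,$$ $$\widehat H_n=\frac{\log\left(4-\dfrac{V^n_{2,2}(X^H)}{V^n_{1,2}(X^H)}\right)}{2\log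 2},$$ with the conventions $0/0=0$ and $\log 0=0$ where the expression would otherwise be undefined. Then $X^H$ is well defined: almost surely, the equation for $X^H_\varepsilon$ has exactly one continuous solution for every $\varepsilon>0$, and the limit $X^H(t)$ exists and is finite for every $t\ge0$. Moreover, $\widehat H_n$ is a (weakly) consistent estimator of $H$: $$\widehat H_n\xrightarrow{\ \mathbb P\ }H,\qquad n\to\infty.$$ -/

import Mathlib

open MeasureTheory ProbabilityTheory Filter Topology
open scoped NNReal

noncomputable section

namespace RoughBessel

/-- `B` is a fractional Brownian motion with Hurst index `H` on the probability space `(Ω, P)`: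
a centered Gaussian process indexed by `[0, ∞)` with covariance function
`(t ^ (2H) + s ^ (2H) - |t - s| ^ (2H)) / 2`. -/
structure IsFractionalBrownianMotion {Ω : Type*} [MeasurableSpace Ω]
    (B : ℝ≥0 → Ω → ℝ) (H : ℝ) (P : Measure Ω) : Prop where
  gaussian : IsGaussianProcess B P
  centered : ∀ t : ℝ≥0, ∫ ω, B t ω ∂P = 0
  covariance : ∀ s t : ℝ≥0, ∫ ω, B t ω * B s ω ∂P =
    (1 / 2) * ((t : ℝ) ^ (2 * H) + (s : ℝ) ^ (2 * H) - |(t : ℝ) - (s : ℝ)| ^ (2 * H))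

/-- The regularized drift `a / (x 1_{x > 0} + ε)`. -/
def drift (a ε x : ℝ) : ℝ :=
  a / (x * (Set.Ioi (0 : ℝ)).indicator (fun _ => 1) x + ε)

/-- The path `x` is a (continuous) solution on `[0, ∞)` of the equation
`x(t) = x₀ + ∫₀ᵗ a / (x(s) 1_{x(s) > 0} + ε) ds + σ w(t)` driven by the path `w`. -/
structure IsPreLimitSolution (x₀ a σ ε : ℝ) (w x : ℝ≥0 → ℝ) : Prop where
  continuous : Continuous x
  eqn : ∀ t : ℝ≥0, x t = x₀ + (∫ s in (0 : ℝ)..t, drift a ε (x s.toNNReal)) + σ * w t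

/-- The solution `X_ε` of the regularized equation driven by the path `w`
(for `ε > 0` and continuous `w` there is exactly one). -/
def preLimit (x₀ a σ ε : ℝ) (w : ℝ≥0 → ℝ) : ℝ≥0 → ℝ :=
  Classical.epsilon (IsPreLimitSolution x₀ a σ ε w)

/-- The path of the rough Bessel process driven by the path `w`:
the pointwise limit of `X_ε` as `ε ↓ 0`. -/
def besselPath (x₀ a σ : ℝ) (w : ℝ≥0 → ℝ) (t : ℝ≥0) : ℝ :=
  limUnder (𝓝[>] (0 : ℝ)) (fun ε => preLimit x₀ a σ ε w t)

/-- The rough Bessel process `X^H` driven by the process `B`. -/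
def roughBessel {Ω : Type*} (x₀ a σ : ℝ) (B : ℝ≥0 → Ω → ℝ) (t : ℝ≥0) (ω : Ω) : ℝ :=
  besselPath x₀ a σ (fun s => B s ω) t

/-- The point `t_k = k T / n` of the uniform partition of `[0, T]`. -/
def gridPoint (T : ℝ≥0) (n k : ℕ) : ℝ≥0 := k * T / n

/-- The first-order quadratic variation `V^n_{1,2}(ξ)` on the uniform partition of `[0, T]`. -/
def V₁ (T : ℝ≥0) (n : ℕ) (ξ : ℝ≥0 → ℝ) : ℝ :=
  ∑ k ∈ Finset.range n, (ξ (gridPoint T n (k + 1)) - ξ (gridPoint T n k)) ^ 2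

/-- The second-order quadratic variation `V^n_{2,2}(ξ)` on the uniform partition of `[0, T]`
(the sum runs over `0 ≤ k ≤ n - 2`). -/
def V₂ (T : ℝ≥0) (n : ℕ) (ξ : ℝ≥0 → ℝ) : ℝ :=
  ∑ k ∈ Finset.range (n - 1),
    (ξ (gridPoint T n (k + 2)) - 2 * ξ (gridPoint T n (k + 1)) + ξ (gridPoint T n k)) ^ 2

/-- The estimator of the Hurst index computed from the values of the path `ξ` on the uniform
partition of `[0, T]` into `n` intervals. -/
def hurstEstimator (T : ℝ≥0) (n : ℕ) (ξ : ℝ≥0 → ℝ) : ℝ :=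
  Real.log (4 - V₂ T n ξ / V₁ T n ξ) / (2 * Real.log 2)

end RoughBessel

end

/-!
The regularized equation becomes, for `z = X_ε - x₀ - σ w`, an ordinary differential equation
`z' = a / ((x₀ + z + σ w)⁺ + ε)`, `z 0 = 0`, with a bounded Lipschitz right-hand side; hence there
is exactly one global solution. Its cumulative drift `z` is nondecreasing in time. By comparison,
`z` increases as `ε` decreases (`IsCumulativeDrift.le_of_lt`), and it stays below the line
`σ M + (a / x₀) t` for any bound `M` on `|w|`, because on this line the solution is at least `x₀`,
where the drift is smaller than `a / x₀` (`IsCumulativeDrift.le_of_abs_le`). So the limit exists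
and has the form `X = x₀ + A + σ B` with a nondecreasing path `A`, whose total increment on `[0, T]`
is dominated by a random variable (`exists_monotone_besselPath_eq`).

Monotonicity makes `A` negligible for the estimator: the sum of the squared increments of `A` is at
most `A(T) ^ 2`, so that `√V₁(X)` and `√V₂(X)` differ from `σ √V₁(B)` and `σ √V₂(B)` by at most
`A(T)` and `2 A(T)`, whereas the latter are of order `n ^ (1 / 2 - H)`, which tends to infinity for
`H < 1 / 2`. No regularity of `X` near zero is needed.

For the noise itself, self-similarity turns the increments of `B` on the grid into stationary
centered Gaussian sequences whose covariance functions do not depend on `n` and vanish at infinity.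
By Isserlis' theorem, the variance of the average of their squares is at most four times the Cesàro
mean of the squared covariances, so a weak law of large numbers holds
(`tendstoInMeasure_average_sq`). It gives `s_n V₁(B) → 1` and `s_n V₂(B) → 4 - 2 ^ (2H)` in
probability, with `s_n = (n / T) ^ (2H) / n`. Hence `4 - V₂(X) / V₁(X) → 2 ^ (2H)`, and the claim
follows by taking logarithms.

Measurability of `X` is never used: deviations of the estimator are controlled by those of the
variations of `B` and of a measurable bound for `A(T)`
(`exists_aemeasurable_forall_abs_le`, `tendstoInMeasure_of_forall_exists`).
-/

/-! ### The regularized equation and its limit -/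

namespace RoughBessel

/-- Global existence for an ordinary differential equation with a bounded, globally Lipschitz
right-hand side. -/
lemma exists_forall_hasDerivAt_of_lipschitz_of_bounded {E : Type*} [NormedAddCommGroup E]
    [NormedSpace ℝ E] [CompleteSpace E] {f : ℝ → E → E} {K L : ℝ≥0}
    (hlip : ∀ t, LipschitzWith K (f t)) (hcont : ∀ x, Continuous fun t => f t x)
    (hbound : ∀ t x, ‖f t x‖ ≤ L) (x₀ : E) :
    ∃ y : ℝ → E, y 0 = x₀ ∧ ∀ t, HasDerivAt y (f t (y t)) t := by
  have hloc : ∀ N : ℕ, ∃ y : ℝ → E, y 0 = x₀ ∧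
      ∀ t ∈ Set.Ioo (-(N : ℝ)) N, HasDerivAt y (f t (y t)) t := by
    intro N
    have hpl : IsPicardLindelof f (tmin := -(N : ℝ)) (tmax := N) ⟨0, by simp, by simp⟩ x₀
        (L * N) 0 L K :=
      { lipschitzOnWith := fun t _ => (hlip t).lipschitzOnWith
        continuousOn := fun x _ => (hcont x).continuousOn
        norm_le := fun t _ x _ => hbound t x
        mul_max_le := by simp }
    obtain ⟨y, hy0, hy⟩ := hpl.exists_eq_forall_mem_Icc_hasDerivWithinAt₀
    exact ⟨y, hy0, fun t ht => (hy t (Set.Ioo_subset_Icc_self ht)).hasDerivAt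
      (Icc_mem_nhds ht.1 ht.2)⟩
  choose y hy0 hy using hloc
  -- The local solutions agree wherever they are defined, so they glue to a global one.
  have hagree : ∀ {M N : ℕ} {t : ℝ}, |t| < M → |t| < N → y M t = y N t := by
    intro M N t hM hN
    have key : ∀ {M N : ℕ} {t : ℝ}, M ≤ N → |t| < M → y M t = y N t := by
      intro M N t hMN hM
      have hMN' : (M : ℝ) ≤ N := by exact_mod_cast hMN
      have hpos : (0 : ℝ) < M := (abs_nonneg t).trans_lt hM
      refine ODE_solution_unique_of_mem_Ioo (v := f) (s := fun _ => Set.univ) (K := K)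
        (t₀ := 0) (fun t _ => (hlip t).lipschitzOnWith) ⟨by linarith, hpos⟩
        (fun s hs => ⟨hy M s hs, trivial⟩)
        (fun s hs => ⟨hy N s ⟨by linarith [hs.1], by linarith [hs.2]⟩, trivial⟩)
        ((hy0 M).trans (hy0 N).symm) (abs_lt.1 hM)
    rcases le_total M N with h | h
    · exact key h hM
    · exact (key h hN).symm
  have hlt : ∀ t : ℝ, |t| < ((⌊|t|⌋₊ + 1 : ℕ) : ℝ) := fun t => by
    push_cast; exact Nat.lt_floor_add_one _
  refine ⟨fun t => y (⌊|t|⌋₊ + 1) t, by simp [hy0], fun t => ?_⟩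
  refine (hy _ t (abs_lt.1 (hlt t))).congr_of_eventuallyEq ?_
  filter_upwards [continuous_abs.continuousAt.eventually_lt continuousAt_const (hlt t)] with s hs
  exact hagree (hlt s) hs

lemma drift_eq (a ε x : ℝ) : drift a ε x = a / (max x 0 + ε) := by
  unfold drift
  by_cases hx : 0 < x
  · simp [hx, max_eq_left hx.le]
  · simp [hx, max_eq_right (not_lt.1 hx)]

lemma drift_pos {a ε : ℝ} (ha : 0 < a) (hε : 0 < ε) (x : ℝ) : 0 < drift a ε x := by
  rw [drift_eq]
  have := le_max_right x 0
  positivity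

lemma drift_le {a ε : ℝ} (ha : 0 < a) (hε : 0 < ε) (x : ℝ) : drift a ε x ≤ a / ε := by
  rw [drift_eq]
  have := le_max_right x 0
  gcongr
  linarith

lemma drift_lt_drift {a ε ε' : ℝ} (ha : 0 < a) (hε : 0 < ε) (h : ε < ε') (x : ℝ) :
    drift a ε' x < drift a ε x := by
  rw [drift_eq, drift_eq]
  have := le_max_right x 0
  gcongr

lemma drift_lt_div {a ε x x₀ : ℝ} (ha : 0 < a) (hε : 0 < ε) (hx₀ : 0 < x₀) (h : x₀ ≤ x) :
    drift a ε x < a / x₀ := by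
  rw [drift_eq]
  have := le_max_left x 0
  gcongr
  linarith

lemma lipschitzWith_drift {a ε : ℝ} (ha : 0 < a) (hε : 0 < ε) :
    LipschitzWith (a / ε ^ 2).toNNReal (drift a ε) := by
  refine LipschitzWith.of_dist_le_mul fun x y => ?_
  rw [Real.coe_toNNReal _ (by positivity), drift_eq, drift_eq, Real.dist_eq, Real.dist_eq]
  have hx := le_max_right x 0
  have hy := le_max_right y 0
  have h : a / (max x 0 + ε) - a / (max y 0 + ε)
      = a * (max y 0 - max x 0) / ((max x 0 + ε) * (max y 0 + ε)) := by
    field_simp; ring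
  rw [h, abs_div, abs_mul, abs_of_pos ha,
    abs_of_pos (by positivity : 0 < (max x 0 + ε) * (max y 0 + ε)), abs_sub_comm, div_mul_eq_mul_div]
  have h2 : ε ^ 2 ≤ (max x 0 + ε) * (max y 0 + ε) := by nlinarith
  have h3 : |max x 0 - max y 0| ≤ |x - y| := abs_max_sub_max_le_abs x y 0
  gcongr

/-- The cumulative drift `z` of a solution: `x t = x₀ + z t + σ w t`, where `z` solves the
random ordinary differential equation `z' = drift (x₀ + z + σ w)` with `z 0 = 0`. The function `z`
lives on `ℝ`, so that the derivative is two-sided also at `0`; only its values on `[0, ∞)` matter. -/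
structure IsCumulativeDrift (x₀ a σ ε : ℝ) (w : ℝ≥0 → ℝ) (z : ℝ → ℝ) : Prop where
  zero : z 0 = 0
  hasDerivAt : ∀ t : ℝ, 0 ≤ t →
    HasDerivAt z (drift a ε (x₀ + z t + σ * w t.toNNReal)) t

variable {x₀ a σ ε ε' : ℝ} {w x : ℝ≥0 → ℝ} {z z' : ℝ → ℝ}

lemma IsPreLimitSolution.exists_isCumulativeDrift (ha : 0 < a) (hε : 0 < ε)
    (hx : IsPreLimitSolution x₀ a σ ε w x) :
    ∃ z, IsCumulativeDrift x₀ a σ ε w z ∧ ∀ t : ℝ≥0, x t = x₀ + z t + σ * w t := by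
  have hc : Continuous fun s : ℝ => drift a ε (x s.toNNReal) :=
    (lipschitzWith_drift ha hε).continuous.comp (hx.continuous.comp continuous_real_toNNReal)
  refine ⟨fun t => ∫ s in (0 : ℝ)..t, drift a ε (x s.toNNReal), ⟨by simp, fun t ht => ?_⟩, hx.eqn⟩
  have h := hx.eqn t.toNNReal
  rw [Real.coe_toNNReal t ht] at h
  rw [← h]
  exact intervalIntegral.integral_hasDerivAt_right (hc.intervalIntegrable _ _)
    (hc.stronglyMeasurableAtFilter _ _) hc.continuousAt

lemma exists_isPreLimitSolution (x₀ σ : ℝ) (ha : 0 < a) (hε : 0 < ε) (hw : Continuous w) :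
    ∃ x, IsPreLimitSolution x₀ a σ ε w x := by
  have hlip := lipschitzWith_drift ha hε
  obtain ⟨y, hy0, hy⟩ := exists_forall_hasDerivAt_of_lipschitz_of_bounded
    (f := fun t y => drift a ε (x₀ + y + σ * w t.toNNReal)) (K := (a / ε ^ 2).toNNReal)
    (L := (a / ε).toNNReal)
    (fun t => LipschitzWith.of_dist_le_mul fun u v => by
      simpa using hlip.dist_le_mul (x₀ + u + σ * w t.toNNReal) (x₀ + v + σ * w t.toNNReal))
    (fun u => hlip.continuous.comp
      (continuous_const.add (continuous_const.mul (hw.comp continuous_real_toNNReal))))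
    (fun t u => by
      rw [Real.norm_of_nonneg (drift_pos ha hε _).le, Real.coe_toNNReal _ (by positivity)]
      exact drift_le ha hε _) 0
  have hyc : Continuous y := continuous_iff_continuousAt.2 fun t => (hy t).continuousAt
  refine ⟨fun t => x₀ + y t + σ * w t, by fun_prop, fun t => ?_⟩
  have hint : ∫ s in (0 : ℝ)..t, drift a ε (x₀ + y s + σ * w s.toNNReal) = y t - y 0 :=
    intervalIntegral.integral_eq_sub_of_hasDerivAt (fun s _ => hy s)
      ((hlip.continuous.comp (by fun_prop)).intervalIntegrable _ _)
  have hcongr : ∫ s in (0 : ℝ)..t, drift a ε (x₀ + y (s.toNNReal : ℝ) + σ * w s.toNNReal)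
      = ∫ s in (0 : ℝ)..t, drift a ε (x₀ + y s + σ * w s.toNNReal) := by
    refine intervalIntegral.integral_congr fun s hs => ?_
    rw [Set.uIcc_of_le (NNReal.coe_nonneg t)] at hs
    simp only [Real.coe_toNNReal s hs.1]
  rw [hcongr, hint, hy0, sub_zero]

lemma IsCumulativeDrift.continuousOn (hz : IsCumulativeDrift x₀ a σ ε w z) :
    ContinuousOn z (Set.Ici 0) :=
  fun t ht => (hz.hasDerivAt t ht).continuousAt.continuousWithinAt

lemma IsCumulativeDrift.unique (ha : 0 < a) (hε : 0 < ε) (hz : IsCumulativeDrift x₀ a σ ε w z)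
    (hz' : IsCumulativeDrift x₀ a σ ε w z') {t : ℝ} (ht : 0 ≤ t) : z t = z' t := by
  refine ODE_solution_unique_of_mem_Icc_right (a := 0) (b := t)
    (v := fun t y => drift a ε (x₀ + y + σ * w t.toNNReal)) (s := fun _ => Set.univ)
    (K := (a / ε ^ 2).toNNReal)
    (fun t _ => (LipschitzWith.of_dist_le_mul fun u v => by
      simpa using (lipschitzWith_drift ha hε).dist_le_mul
        (x₀ + u + σ * w t.toNNReal) (x₀ + v + σ * w t.toNNReal)).lipschitzOnWith)
    (hz.continuousOn.mono Set.Icc_subset_Ici_self)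
    (fun s hs => (hz.hasDerivAt s hs.1).hasDerivWithinAt) (fun _ _ => trivial)
    (hz'.continuousOn.mono Set.Icc_subset_Ici_self)
    (fun s hs => (hz'.hasDerivAt s hs.1).hasDerivWithinAt) (fun _ _ => trivial)
    (hz.zero.trans hz'.zero.symm) ⟨ht, le_rfl⟩

lemma IsCumulativeDrift.monotoneOn (ha : 0 < a) (hε : 0 < ε)
    (hz : IsCumulativeDrift x₀ a σ ε w z) : MonotoneOn z (Set.Ici 0) := by
  refine monotoneOn_of_deriv_nonneg (convex_Ici 0) hz.continuousOn
    (fun t ht => ?_) (fun t ht => ?_) <;> rw [interior_Ici] at ht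
  · exact (hz.hasDerivAt t ht.le).differentiableAt.differentiableWithinAt
  · rw [(hz.hasDerivAt t ht.le).deriv]
    exact (drift_pos ha hε _).le

/-- Comparison in the regularization parameter: a smaller `ε` gives a stronger push upwards. -/
lemma IsCumulativeDrift.le_of_lt (ha : 0 < a) (hε : 0 < ε) (h : ε < ε')
    (hz : IsCumulativeDrift x₀ a σ ε w z) (hz' : IsCumulativeDrift x₀ a σ ε' w z')
    {t : ℝ} (ht : 0 ≤ t) : z' t ≤ z t := by
  refine image_le_of_deriv_right_lt_deriv_boundary' (a := 0) (b := t)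
    (hz'.continuousOn.mono Set.Icc_subset_Ici_self)
    (fun s hs => (hz'.hasDerivAt s hs.1).hasDerivWithinAt) (hz'.zero.trans hz.zero.symm).le
    (hz.continuousOn.mono Set.Icc_subset_Ici_self)
    (fun s hs => (hz.hasDerivAt s hs.1).hasDerivWithinAt) (fun s _ heq => ?_) ⟨ht, le_rfl⟩
  rw [heq]
  exact drift_lt_drift ha hε h _

/-- A bound uniform in `ε`: whenever `z` reaches the line `σ M + (a / x₀) t`, the solution
`x₀ + z + σ w` is at least `x₀`, so that `z` grows there more slowly than the line. -/
lemma IsCumulativeDrift.le_of_abs_le (hx₀ : 0 < x₀) (ha : 0 < a) (hσ : 0 < σ) (hε : 0 < ε)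
    (hz : IsCumulativeDrift x₀ a σ ε w z) {M : ℝ} (hM : 0 ≤ M) {T : ℝ≥0}
    (hw : ∀ t ≤ T, |w t| ≤ M) : z T ≤ σ * M + a / x₀ * T := by
  refine image_le_of_deriv_right_lt_deriv_boundary' (a := 0) (b := T)
    (B := fun t => σ * M + a / x₀ * t) (B' := fun _ => a / x₀)
    (hz.continuousOn.mono Set.Icc_subset_Ici_self)
    (fun s hs => (hz.hasDerivAt s hs.1).hasDerivWithinAt) (by rw [hz.zero]; simp; positivity)
    (by fun_prop)
    (fun s hs => by simpa using
      ((hasDerivAt_id s).const_mul (a / x₀) |>.const_add (σ * M)).hasDerivWithinAt)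
    (fun s hs heq => ?_) ⟨T.2, le_rfl⟩
  refine drift_lt_div ha hε hx₀ ?_
  have h1 := (abs_le.1 (hw s.toNNReal (Real.toNNReal_le_iff_le_coe.2 hs.2.le))).1
  have h2 : 0 ≤ a / x₀ * s := mul_nonneg (by positivity) hs.1
  have h3 : z s = σ * M + a / x₀ * s := heq
  nlinarith

lemma existsUnique_isPreLimitSolution (x₀ σ : ℝ) (ha : 0 < a) (hε : 0 < ε) (hw : Continuous w) :
    ∃! x, IsPreLimitSolution x₀ a σ ε w x := by
  obtain ⟨x, hx⟩ := exists_isPreLimitSolution x₀ σ ha hε hw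
  refine ⟨x, hx, fun x' hx' => funext fun t => ?_⟩
  obtain ⟨z, hz, hxz⟩ := hx.exists_isCumulativeDrift ha hε
  obtain ⟨z', hz', hxz'⟩ := hx'.exists_isCumulativeDrift ha hε
  rw [hxz, hxz', hz.unique ha hε hz' (NNReal.coe_nonneg t)]

/-- The limit of the regularized solutions exists, and the Bessel path is the sum of the noise and
a nondecreasing path, whose total increment is controlled by the size of the noise. -/
theorem exists_monotone_besselPath_eq (hx₀ : 0 < x₀) (ha : 0 < a) (hσ : 0 < σ)
    (hw : Continuous w) :
    (∀ t, Tendsto (fun ε => preLimit x₀ a σ ε w t) (𝓝[>] 0) (𝓝 (besselPath x₀ a σ w t))) ∧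
    ∃ A : ℝ≥0 → ℝ, Monotone A ∧ A 0 = 0 ∧ (∀ t, besselPath x₀ a σ w t = x₀ + A t + σ * w t) ∧
      ∀ (T : ℝ≥0) (M : ℝ), 0 ≤ M → (∀ t ≤ T, |w t| ≤ M) → A T ≤ σ * M + a / x₀ * T := by
  have hsol : ∀ ε, 0 < ε → IsPreLimitSolution x₀ a σ ε w (preLimit x₀ a σ ε w) := fun ε hε =>
    Classical.epsilon_spec (exists_isPreLimitSolution x₀ σ ha hε hw)
  choose! z hz hxz using fun ε hε => (hsol ε hε).exists_isCumulativeDrift ha hε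
  have hbdd : ∀ t : ℝ≥0, BddAbove ((fun ε => z ε t) '' Set.Ioi 0) := by
    intro t
    obtain ⟨M, hM⟩ := (isCompact_Icc (a := 0) (b := t)).bddAbove_image
      (f := fun s => |w s|) (by fun_prop)
    have hM' : ∀ s ≤ t, |w s| ≤ M := fun s hs => hM ⟨s, ⟨zero_le, hs⟩, rfl⟩
    refine ⟨σ * M + a / x₀ * t, ?_⟩
    rintro _ ⟨ε, hε, rfl⟩
    exact (hz ε hε).le_of_abs_le hx₀ ha hσ hε ((abs_nonneg _).trans (hM' t le_rfl)) hM'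
  have hanti : ∀ t : ℝ≥0, AntitoneOn (fun ε => z ε t) (Set.Ioi 0) := by
    intro t ε hε ε' hε' h
    rcases h.eq_or_lt with rfl | h
    · exact le_rfl
    · exact (hz ε hε).le_of_lt ha hε h (hz ε' hε') t.2
  let A : ℝ≥0 → ℝ := fun t => sSup ((fun ε => z ε t) '' Set.Ioi 0)
  have hA : ∀ t : ℝ≥0, Tendsto (fun ε => z ε t) (𝓝[>] 0) (𝓝 (A t)) := fun t =>
    (hanti t).tendsto_nhdsGT (hbdd t)
  have hpos : ∀ᶠ ε : ℝ in 𝓝[>] 0, 0 < ε := self_mem_nhdsWithin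
  have hlim : ∀ t, Tendsto (fun ε => preLimit x₀ a σ ε w t) (𝓝[>] 0)
      (𝓝 (x₀ + A t + σ * w t)) := by
    intro t
    refine (((hA t).const_add x₀).add_const (σ * w t)).congr' ?_
    filter_upwards [hpos] with ε hε using (hxz ε hε t).symm
  have heq : ∀ t, besselPath x₀ a σ w t = x₀ + A t + σ * w t := fun t => (hlim t).limUnder_eq
  refine ⟨fun t => heq t ▸ hlim t, A, fun s t hst => ?_, ?_, heq, fun T M hM hwM => ?_⟩
  · refine le_of_tendsto_of_tendsto (hA s) (hA t) ?_
    filter_upwards [hpos] with ε hε using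
      (hz ε hε).monotoneOn ha hε s.2 t.2 (NNReal.coe_le_coe.2 hst)
  · refine tendsto_nhds_unique (hA 0) (tendsto_const_nhds.congr' ?_)
    filter_upwards [hpos] with ε hε using (hz ε hε).zero.symm
  · refine le_of_tendsto (hA T) ?_
    filter_upwards [hpos] with ε hε using (hz ε hε).le_of_abs_le hx₀ ha hσ hε hM hwM

end RoughBessel

/-! ### A law of large numbers for squares of Gaussian arrays -/

namespace RoughBessel

lemma integral_pow_four_gaussianReal (v : ℝ≥0) :
    ∫ x, x ^ 4 ∂(gaussianReal 0 v) = 3 * (v : ℝ) ^ 2 := by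
  have h : ∫ x, x ^ 4 ∂(gaussianReal 0 v)
      = iteratedDeriv 4 (mgf (fun x => x) (gaussianReal 0 v)) 0 := by
    rw [iteratedDeriv_mgf_zero] <;> simp
  have hexp : ∀ t : ℝ, HasDerivAt (fun t : ℝ => Real.exp (v * t ^ 2 / 2))
      (Real.exp (v * t ^ 2 / 2) * (v * t)) t := by
    intro t
    have h := (((hasDerivAt_pow 2 t).const_mul (v : ℝ)).div_const 2).exp
    convert h using 1
    simp; ring
  -- Each derivative has the form `p(t) exp (v t² / 2)` with a polynomial `p`.
  have hstep : ∀ {p p' : ℝ → ℝ}, (∀ t, HasDerivAt p (p' t) t) →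
      deriv (fun t => p t * Real.exp (v * t ^ 2 / 2))
        = fun t => (p' t + p t * (v * t)) * Real.exp (v * t ^ 2 / 2) := by
    intro p p' hp
    ext t
    rw [((hp t).fun_mul (hexp t)).deriv]
    ring
  have e1 : deriv (fun t : ℝ => Real.exp (v * t ^ 2 / 2))
      = fun t => (v * t) * Real.exp (v * t ^ 2 / 2) := by
    ext t; rw [(hexp t).deriv]; ring
  have hid : ∀ t : ℝ, HasDerivAt (fun t : ℝ => t) 1 t := hasDerivAt_id
  have e2 := hstep (p := fun t => v * t) (p' := fun _ => v)
    (fun t => by simpa using (hid t).const_mul (v : ℝ))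
  have e3 := hstep (p := fun t => v + v * t * (v * t)) (p' := fun t => 2 * v ^ 2 * t)
    (fun t => by
      refine HasDerivAt.congr_deriv
        ((((hid t).const_mul (v : ℝ)).fun_mul ((hid t).const_mul (v : ℝ))).const_add (v : ℝ)) ?_
      ring)
  have e4 := hstep (p := fun t => 2 * v ^ 2 * t + (v + v * t * (v * t)) * (v * t))
    (p' := fun t => 3 * v ^ 2 + 3 * v ^ 3 * t ^ 2)
    (fun t => by
      refine HasDerivAt.congr_deriv (((hid t).const_mul (2 * (v : ℝ) ^ 2)).fun_add
        (((((hid t).const_mul (v : ℝ)).fun_mul ((hid t).const_mul (v : ℝ))).const_add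
          (v : ℝ)).fun_mul ((hid t).const_mul (v : ℝ)))) ?_
      ring)
  rw [h, mgf_fun_id_gaussianReal, iteratedDeriv_succ, iteratedDeriv_succ, iteratedDeriv_succ,
    iteratedDeriv_one]
  simp only [zero_mul, zero_add]
  rw [e1, e2, e3, e4]
  simp

variable {Ω : Type*} [MeasurableSpace Ω] {P : Measure Ω}

lemma integral_pow_four_of_hasGaussianLaw {X : Ω → ℝ} (hX : HasGaussianLaw X P)
    (h0 : ∫ ω, X ω ∂P = 0) : ∫ ω, X ω ^ 4 ∂P = 3 * (∫ ω, X ω ^ 2 ∂P) ^ 2 := by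
  have hm := hX.aemeasurable
  have hvar : Var[X; P] = ∫ ω, X ω ^ 2 ∂P := by
    rw [variance_eq_integral hm, h0]; simp
  have h1 : ∫ ω, X ω ^ 4 ∂P = ∫ x, x ^ 4 ∂(P.map X) := by
    rw [integral_map hm (by fun_prop)]
  rw [h1, hX.map_eq_gaussianReal, h0, integral_pow_four_gaussianReal,
    Real.coe_toNNReal _ (variance_nonneg _ _), hvar]

lemma integrable_mul_of_hasGaussianLaw {X Y : Ω → ℝ} (hX : HasGaussianLaw X P)
    (hY : HasGaussianLaw Y P) : Integrable (fun ω => X ω * Y ω) P :=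
  hX.memLp_two.integrable_mul hY.memLp_two

lemma memLp_two_sq_of_hasGaussianLaw {X : Ω → ℝ} (hX : HasGaussianLaw X P) :
    MemLp (fun ω => X ω ^ 2) 2 P := by
  have := hX.isProbabilityMeasure
  have h4 : MemLp X 4 P := hX.memLp (by norm_num)
  have h := MemLp.mul (p := 4) (q := 4) (r := 2) h4 h4 (hpqr := ⟨by
    rw [← two_mul, show (4 : ENNReal) = 2 * 2 by norm_num, ENNReal.mul_inv (by simp) (by simp),
      ← mul_assoc, ENNReal.mul_inv_cancel (by simp) (by simp), one_mul]⟩)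
  convert h using 1
  ext ω; simp [sq]

lemma integrable_pow_four_of_hasGaussianLaw {X : Ω → ℝ} (hX : HasGaussianLaw X P) :
    Integrable (fun ω => X ω ^ 4) P := by
  have h := (memLp_two_sq_of_hasGaussianLaw hX).integrable_sq
  refine h.congr (ae_of_all _ fun ω => ?_)
  simp only; ring

/-- The covariance of the squares of two centered jointly Gaussian variables is twice the square
of their covariance (a case of Isserlis' theorem). By polarization, it follows from the fourth
moments of `X`, `Y`, `X + Y` and `X - Y`. -/
lemma integral_sq_mul_sq_of_hasGaussianLaw {X Y : Ω → ℝ}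
    (hXY : HasGaussianLaw (fun ω => (X ω, Y ω)) P) (hX0 : ∫ ω, X ω ∂P = 0)
    (hY0 : ∫ ω, Y ω ∂P = 0) :
    ∫ ω, X ω ^ 2 * Y ω ^ 2 ∂P
      = (∫ ω, X ω ^ 2 ∂P) * (∫ ω, Y ω ^ 2 ∂P) + 2 * (∫ ω, X ω * Y ω ∂P) ^ 2 := by
  have hX : HasGaussianLaw X P := hXY.fst
  have hY : HasGaussianLaw Y P := hXY.snd
  have hA := hXY.fun_add
  have hS := hXY.fun_sub
  have iX := hX.memLp_two.integrable_sq
  have iY := hY.memLp_two.integrable_sq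
  have iXY := integrable_mul_of_hasGaussianLaw hX hY
  have iS : Integrable (fun ω => X ω ^ 2 + Y ω ^ 2) P := iX.add iY
  have hA0 : ∫ ω, (X ω + Y ω) ∂P = 0 := by
    rw [integral_add hX.integrable hY.integrable, hX0, hY0, add_zero]
  have hS0 : ∫ ω, (X ω - Y ω) ∂P = 0 := by
    rw [integral_sub hX.integrable hY.integrable, hX0, hY0, sub_zero]
  have hA2 : ∫ ω, (X ω + Y ω) ^ 2 ∂P
      = ∫ ω, X ω ^ 2 ∂P + ∫ ω, Y ω ^ 2 ∂P + 2 * ∫ ω, X ω * Y ω ∂P := by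
    rw [← integral_add iX iY, ← integral_const_mul, ← integral_add iS (iXY.const_mul 2)]
    congr 1; ext ω; ring
  have hS2 : ∫ ω, (X ω - Y ω) ^ 2 ∂P
      = ∫ ω, X ω ^ 2 ∂P + ∫ ω, Y ω ^ 2 ∂P - 2 * ∫ ω, X ω * Y ω ∂P := by
    rw [← integral_add iX iY, ← integral_const_mul, ← integral_sub iS (iXY.const_mul 2)]
    congr 1; ext ω; ring
  have i4X := integrable_pow_four_of_hasGaussianLaw hX
  have i4Y := integrable_pow_four_of_hasGaussianLaw hY
  have i4A := integrable_pow_four_of_hasGaussianLaw hA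
  have i4S := integrable_pow_four_of_hasGaussianLaw hS
  have i4AS : Integrable (fun ω => (X ω + Y ω) ^ 4 + (X ω - Y ω) ^ 4) P := i4A.add i4S
  have i4XY : Integrable (fun ω => X ω ^ 4 + Y ω ^ 4) P := i4X.add i4Y
  have hpol : ∫ ω, X ω ^ 2 * Y ω ^ 2 ∂P = (1 / 12) * (∫ ω, (X ω + Y ω) ^ 4 ∂P
      + ∫ ω, (X ω - Y ω) ^ 4 ∂P - 2 * (∫ ω, X ω ^ 4 ∂P + ∫ ω, Y ω ^ 4 ∂P)) := by
    rw [← integral_add i4A i4S, ← integral_add i4X i4Y, ← integral_const_mul,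
      ← integral_sub i4AS (i4XY.const_mul 2), ← integral_const_mul]
    congr 1; ext ω; ring
  rw [hpol, integral_pow_four_of_hasGaussianLaw hX hX0, integral_pow_four_of_hasGaussianLaw hY hY0,
    integral_pow_four_of_hasGaussianLaw hA hA0, integral_pow_four_of_hasGaussianLaw hS hS0,
    hA2, hS2]
  ring

/-- A bound for the variance of the sum of squares of a centered stationary Gaussian sequence:
the squares have covariance `2 r(k - j) ^ 2`, and every lag occurs at most twice in each row. -/
lemma integral_sum_sq_sub_sq_le {Y : ℕ → Ω → ℝ} (hY : IsGaussianProcess Y P)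
    (h0 : ∀ k, ∫ ω, Y k ω ∂P = 0) {r : ℕ → ℝ}
    (hcov : ∀ j k, ∫ ω, Y j ω * Y (j + k) ω ∂P = r k) (N : ℕ) :
    ∫ ω, (∑ k ∈ Finset.range N, Y k ω ^ 2 - N * r 0) ^ 2 ∂P
      ≤ 4 * N * ∑ m ∈ Finset.range N, r m ^ 2 := by
  have := hY.isProbabilityMeasure
  have hr0 : ∀ k, ∫ ω, Y k ω ^ 2 ∂P = r 0 := fun k => by
    rw [← hcov k 0]; congr 1; ext ω; simp [sq]
  have hL2 : ∀ k, MemLp (fun ω => Y k ω ^ 2 - r 0) 2 P := fun k =>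
    (memLp_two_sq_of_hasGaussianLaw (hY.hasGaussianLaw_eval k)).sub (memLp_const _)
  have hint : ∀ j k, Integrable (fun ω => (Y j ω ^ 2 - r 0) * (Y k ω ^ 2 - r 0)) P :=
    fun j k => (hL2 j).integrable_mul (hL2 k)
  have hterm : ∀ j m, ∫ ω, (Y j ω ^ 2 - r 0) * (Y (j + m) ω ^ 2 - r 0) ∂P = 2 * r m ^ 2 := by
    intro j m
    have i1 : Integrable (fun ω => Y j ω ^ 2 * Y (j + m) ω ^ 2) P :=
      (memLp_two_sq_of_hasGaussianLaw (hY.hasGaussianLaw_eval j)).integrable_mul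
        (memLp_two_sq_of_hasGaussianLaw (hY.hasGaussianLaw_eval (j + m)))
    have i2 := (hY.hasGaussianLaw_eval j).memLp_two.integrable_sq
    have i3 := (hY.hasGaussianLaw_eval (j + m)).memLp_two.integrable_sq
    have i4 : Integrable (fun ω => r 0 * (Y j ω ^ 2 + Y (j + m) ω ^ 2)) P :=
      (i2.add i3).const_mul _
    have i5 : Integrable
        (fun ω => Y j ω ^ 2 * Y (j + m) ω ^ 2 - r 0 * (Y j ω ^ 2 + Y (j + m) ω ^ 2)) P := i1.sub i4
    have hexp : ∫ ω, (Y j ω ^ 2 - r 0) * (Y (j + m) ω ^ 2 - r 0) ∂P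
        = ∫ ω, Y j ω ^ 2 * Y (j + m) ω ^ 2 ∂P
          - r 0 * (∫ ω, Y j ω ^ 2 ∂P + ∫ ω, Y (j + m) ω ^ 2 ∂P) + r 0 ^ 2 := by
      have hc : ∫ _ : Ω, r 0 ^ 2 ∂P = r 0 ^ 2 := by simp
      calc _ = ∫ ω, (Y j ω ^ 2 * Y (j + m) ω ^ 2 - r 0 * (Y j ω ^ 2 + Y (j + m) ω ^ 2)
            + r 0 ^ 2) ∂P := by congr 1; ext ω; ring
        _ = _ := by
          rw [integral_add i5 (integrable_const _), integral_sub i1 i4, integral_const_mul,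
            integral_add i2 i3, hc]
    rw [hexp, integral_sq_mul_sq_of_hasGaussianLaw hY.hasGaussianLaw_prodMk (h0 _) (h0 _),
      hr0, hr0, hcov]
    ring
  have hsum : ∫ ω, (∑ k ∈ Finset.range N, Y k ω ^ 2 - N * r 0) ^ 2 ∂P
      = ∑ j ∈ Finset.range N, ∑ k ∈ Finset.range N,
        ∫ ω, (Y j ω ^ 2 - r 0) * (Y k ω ^ 2 - r 0) ∂P := by
    have : ∀ ω, (∑ k ∈ Finset.range N, Y k ω ^ 2 - N * r 0) ^ 2
        = ∑ j ∈ Finset.range N, ∑ k ∈ Finset.range N, (Y j ω ^ 2 - r 0) * (Y k ω ^ 2 - r 0) := by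
      intro ω
      rw [← Finset.sum_mul_sum, ← sq, Finset.sum_sub_distrib]
      simp
    simp_rw [this]
    rw [integral_finsetSum _ fun j _ => integrable_finsetSum _ fun k _ => hint j k]
    exact Finset.sum_congr rfl fun j _ => integral_finsetSum _ fun k _ => hint j k
  -- The `j`-th row of the covariance matrix splits into the lags `k - j` and `j - k`.
  have hrow : ∀ j ∈ Finset.range N, ∑ k ∈ Finset.range N,
      ∫ ω, (Y j ω ^ 2 - r 0) * (Y k ω ^ 2 - r 0) ∂P ≤ 4 * ∑ m ∈ Finset.range N, r m ^ 2 := by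
    intro j hj
    have hjN : j < N := Finset.mem_range.1 hj
    have hle : ∀ k ∈ Finset.range N, ∫ ω, (Y j ω ^ 2 - r 0) * (Y k ω ^ 2 - r 0) ∂P
        ≤ (if k ≤ j then 2 * r (j - k) ^ 2 else 0) + (if j ≤ k then 2 * r (k - j) ^ 2 else 0) := by
      intro k _
      rcases le_total k j with h | h
      · obtain ⟨m, rfl⟩ := Nat.exists_eq_add_of_le h
        simp_rw [mul_comm (Y (k + m) _ ^ 2 - r 0)]
        rw [hterm, if_pos h, Nat.add_sub_cancel_left]
        have : 0 ≤ if k + m ≤ k then 2 * r (k - (k + m)) ^ 2 else 0 := by split_ifs <;> positivity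
        linarith
      · obtain ⟨m, rfl⟩ := Nat.exists_eq_add_of_le h
        rw [hterm, if_pos h, Nat.add_sub_cancel_left]
        have : 0 ≤ if j + m ≤ j then 2 * r (j - (j + m)) ^ 2 else 0 := by split_ifs <;> positivity
        linarith
    have hnn : ∀ m, 0 ≤ 2 * r m ^ 2 := fun m => by positivity
    have h1 : ∑ k ∈ Finset.range N, (if k ≤ j then 2 * r (j - k) ^ 2 else 0)
        ≤ ∑ m ∈ Finset.range N, 2 * r m ^ 2 := by
      rw [← Finset.sum_filter]
      refine (Finset.sum_le_sum_of_subset_of_nonneg (t := Finset.range (j + 1)) (fun k hk => ?_)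
        (fun _ _ _ => hnn _)).trans ?_
      · simp only [Finset.mem_filter, Finset.mem_range] at hk ⊢; omega
      · have := Finset.sum_range_reflect (fun m => 2 * r m ^ 2) (j + 1)
        simp only [Nat.add_sub_cancel] at this
        rw [this]
        exact Finset.sum_le_sum_of_subset_of_nonneg (Finset.range_mono hjN) (fun _ _ _ => hnn _)
    have h2 : ∑ k ∈ Finset.range N, (if j ≤ k then 2 * r (k - j) ^ 2 else 0)
        ≤ ∑ m ∈ Finset.range N, 2 * r m ^ 2 := by
      rw [← Finset.sum_filter]
      have hIco : (Finset.range N).filter (j ≤ ·) = Finset.Ico j N := by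
        ext k; simp; omega
      rw [hIco, Finset.sum_Ico_eq_sum_range]
      simp only [Nat.add_sub_cancel_left]
      exact Finset.sum_le_sum_of_subset_of_nonneg (Finset.range_mono (Nat.sub_le _ _))
        (fun _ _ _ => hnn _)
    calc _ ≤ _ := Finset.sum_le_sum hle
      _ ≤ ∑ m ∈ Finset.range N, 2 * r m ^ 2 + ∑ m ∈ Finset.range N, 2 * r m ^ 2 := by
          rw [Finset.sum_add_distrib]; exact add_le_add h1 h2
      _ = 4 * ∑ m ∈ Finset.range N, r m ^ 2 := by rw [← Finset.mul_sum]; ring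
  rw [hsum]
  refine (Finset.sum_le_sum hrow).trans ?_
  rw [Finset.sum_const, Finset.card_range, nsmul_eq_mul]
  exact le_of_eq (by ring)

/-- Convergence in measure to a constant is inherited by functions that are pointwise controlled by
a convergent sequence. Nothing needs to be measurable. -/
lemma tendstoInMeasure_of_forall_exists {E F : Type*} [PseudoMetricSpace E] [PseudoMetricSpace F]
    {U : ℕ → Ω → E} {u : E} (hU : TendstoInMeasure P U atTop fun _ => u) {f : ℕ → Ω → F} {c : F}
    (h : ∀ δ > 0, ∃ η > 0, ∀ᶠ n in atTop, ∀ᵐ ω ∂P,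
      dist (U n ω) u < η → dist (f n ω) c < δ) :
    TendstoInMeasure P f atTop fun _ => c := by
  rw [tendstoInMeasure_iff_dist] at hU ⊢
  intro δ hδ
  obtain ⟨η, hη, hev⟩ := h δ hδ
  refine tendsto_of_tendsto_of_tendsto_of_le_of_le' tendsto_const_nhds (hU η hη)
    (Eventually.of_forall fun _ => zero_le) ?_
  filter_upwards [hev] with n hn
  refine measure_mono_ae ?_
  filter_upwards [hn] with ω hω h1
  by_contra h2
  exact (not_lt.2 h1) (hω (not_le.1 h2))

lemma tendstoInMeasure_prodMk {E F : Type*} [PseudoMetricSpace E] [PseudoMetricSpace F]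
    {U : ℕ → Ω → E} {V : ℕ → Ω → F} {u : E} {v : F}
    (hU : TendstoInMeasure P U atTop fun _ => u) (hV : TendstoInMeasure P V atTop fun _ => v) :
    TendstoInMeasure P (fun n ω => (U n ω, V n ω)) atTop fun _ => (u, v) := by
  rw [tendstoInMeasure_iff_dist] at hU hV ⊢
  intro δ hδ
  have hsum := (hU δ hδ).add (hV δ hδ)
  rw [add_zero] at hsum
  refine tendsto_of_tendsto_of_tendsto_of_le_of_le tendsto_const_nhds hsum
    (fun _ => zero_le) fun n => ?_
  refine (measure_mono fun ω hω => ?_).trans (measure_union_le _ _)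
  have hω' : δ ≤ max (dist (U n ω) u) (dist (V n ω) v) := hω
  exact le_max_iff.1 hω'

/-- The weak law of large numbers for the squares in a triangular array whose rows are centered
stationary Gaussian sequences with a common covariance function `r` vanishing at infinity. -/
theorem tendstoInMeasure_average_sq {Y : ℕ → ℕ → Ω → ℝ}
    (hY : ∀ n, IsGaussianProcess (Y n) P) (h0 : ∀ n k, ∫ ω, Y n k ω ∂P = 0) {r : ℕ → ℝ}
    (hr : Tendsto r atTop (𝓝 0))
    (hcov : ∀ n, 0 < n → ∀ j k, ∫ ω, Y n j ω * Y n (j + k) ω ∂P = r k) {N : ℕ → ℕ}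
    (hN : ∀ n, N n ≤ n) (hN1 : Tendsto (fun n => (N n : ℝ) / n) atTop (𝓝 1)) :
    TendstoInMeasure P (fun n ω => (∑ k ∈ Finset.range (N n), Y n k ω ^ 2) / n) atTop
      (fun _ => r 0) := by
  have := (hY 0).isProbabilityMeasure
  have hces : Tendsto (fun n : ℕ => 4 * ((n : ℝ)⁻¹ * ∑ m ∈ Finset.range n, r m ^ 2))
      atTop (𝓝 0) := by
    simpa using ((hr.pow 2).cesaro).const_mul 4
  have hbound : ∀ n, 0 < n → ∫ ω, ((∑ k ∈ Finset.range (N n), Y n k ω ^ 2) / n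
      - (N n : ℝ) / n * r 0) ^ 2 ∂P ≤ 4 * ((n : ℝ)⁻¹ * ∑ m ∈ Finset.range n, r m ^ 2) := by
    intro n hn
    have hn' : (0 : ℝ) < n := by exact_mod_cast hn
    have hNn : (N n : ℝ) ≤ n := by exact_mod_cast hN n
    have heq : ∀ ω, ((∑ k ∈ Finset.range (N n), Y n k ω ^ 2) / n - (N n : ℝ) / n * r 0) ^ 2
        = ((n : ℝ) ^ 2)⁻¹ * (∑ k ∈ Finset.range (N n), Y n k ω ^ 2 - N n * r 0) ^ 2 := by
      intro ω; field_simp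
    simp_rw [heq]
    rw [integral_const_mul]
    have hmono : ∑ m ∈ Finset.range (N n), r m ^ 2 ≤ ∑ m ∈ Finset.range n, r m ^ 2 :=
      Finset.sum_le_sum_of_subset_of_nonneg (Finset.range_mono (hN n)) fun _ _ _ => sq_nonneg _
    have hnn : 0 ≤ ∑ m ∈ Finset.range (N n), r m ^ 2 := Finset.sum_nonneg fun _ _ => sq_nonneg _
    calc _ ≤ ((n : ℝ) ^ 2)⁻¹ * (4 * N n * ∑ m ∈ Finset.range (N n), r m ^ 2) := by
          gcongr; exact integral_sum_sq_sub_sq_le (hY n) (h0 n) (hcov n hn) _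
      _ ≤ ((n : ℝ) ^ 2)⁻¹ * (4 * n * ∑ m ∈ Finset.range n, r m ^ 2) := by gcongr
      _ = _ := by field_simp
  have hL2 : ∀ n, MemLp (fun ω => (∑ k ∈ Finset.range (N n), Y n k ω ^ 2) / n
      - (N n : ℝ) / n * r 0) 2 P := by
    intro n
    refine MemLp.sub ?_ (memLp_const _)
    simp_rw [div_eq_inv_mul]
    exact (memLp_finsetSum _ fun k _ =>
      memLp_two_sq_of_hasGaussianLaw ((hY n).hasGaussianLaw_eval k)).const_mul _
  -- Chebyshev's inequality
  have hcheb : TendstoInMeasure P (fun n ω => (∑ k ∈ Finset.range (N n), Y n k ω ^ 2) / n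
      - (N n : ℝ) / n * r 0) atTop (fun _ => 0) := by
    rw [tendstoInMeasure_iff_measureReal_dist]
    intro δ hδ
    have hlim : Tendsto (fun n : ℕ => (δ ^ 2)⁻¹ *
        (4 * ((n : ℝ)⁻¹ * ∑ m ∈ Finset.range n, r m ^ 2))) atTop (𝓝 0) := by
      simpa using hces.const_mul (δ ^ 2)⁻¹
    refine tendsto_of_tendsto_of_tendsto_of_le_of_le' tendsto_const_nhds hlim
      (Eventually.of_forall fun _ => measureReal_nonneg) ?_
    filter_upwards [eventually_gt_atTop 0] with n hn
    rw [le_inv_mul_iff₀ (by positivity)]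
    refine le_trans ?_ ((mul_meas_ge_le_integral_of_nonneg (ae_of_all _ fun ω => sq_nonneg _)
      (hL2 n).integrable_sq (δ ^ 2)).trans (hbound n hn))
    refine mul_le_mul_of_nonneg_left (measureReal_mono fun ω hω => ?_) (by positivity)
    have hω' : δ ≤ |(∑ k ∈ Finset.range (N n), Y n k ω ^ 2) / n - (N n : ℝ) / n * r 0| := by
      simpa [Real.dist_eq] using hω
    calc δ ^ 2 ≤ _ := pow_le_pow_left₀ hδ.le hω' 2
      _ = _ := sq_abs _
  refine tendstoInMeasure_of_forall_exists hcheb fun δ hδ => ⟨δ / 2, by positivity, ?_⟩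
  have hN2 : Tendsto (fun n => (N n : ℝ) / n * r 0) atTop (𝓝 (r 0)) := by
    simpa using hN1.mul_const (r 0)
  filter_upwards [(Metric.tendsto_nhds.1 hN2) (δ / 2) (by positivity)] with n hn
  refine ae_of_all _ fun ω hω => ?_
  rw [Real.dist_eq] at *
  rw [sub_zero] at hω
  calc _ = |((∑ k ∈ Finset.range (N n), Y n k ω ^ 2) / n - (N n : ℝ) / n * r 0)
        + ((N n : ℝ) / n * r 0 - r 0)| := by ring_nf
    _ ≤ _ := abs_add_le _ _
    _ < δ := by linarith

end RoughBessel

/-! ### Quadratic variations of fractional Brownian motion -/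

namespace RoughBessel

variable {Ω : Type*} [MeasurableSpace Ω] {P : Measure Ω}

lemma isGaussianProcess_increment {G : ℕ → Ω → ℝ} (hG : IsGaussianProcess G P) :
    IsGaussianProcess (fun k ω => G (k + 1) ω - G k ω) P := by
  classical
  exact hG.of_isGaussianProcess fun k => ⟨{k, k + 1},
    { toFun x := x ⟨k + 1, by simp⟩ - x ⟨k, by simp⟩
      map_add' x y := by simp; abel
      map_smul' c x := by simp; ring },
    by simp⟩

lemma integral_increment_mul_increment {G : ℕ → Ω → ℝ} (hG : IsGaussianProcess G P) (i j : ℕ) :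
    ∫ ω, (G (i + 1) ω - G i ω) * (G (j + 1) ω - G j ω) ∂P
      = ∫ ω, G (i + 1) ω * G (j + 1) ω ∂P - ∫ ω, G (i + 1) ω * G j ω ∂P
        - (∫ ω, G i ω * G (j + 1) ω ∂P - ∫ ω, G i ω * G j ω ∂P) := by
  have hint : ∀ a b, Integrable (fun ω => G a ω * G b ω) P := fun a b =>
    integrable_mul_of_hasGaussianLaw (hG.hasGaussianLaw_eval a) (hG.hasGaussianLaw_eval b)
  have h1 : Integrable (fun ω => G (i + 1) ω * G (j + 1) ω - G (i + 1) ω * G j ω) P :=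
    (hint _ _).sub (hint _ _)
  have h2 : Integrable (fun ω => G i ω * G (j + 1) ω - G i ω * G j ω) P :=
    (hint _ _).sub (hint _ _)
  rw [← integral_sub (hint _ _) (hint _ _), ← integral_sub (hint _ _) (hint _ _),
    ← integral_sub h1 h2]
  congr 1; ext ω; ring

lemma integral_increment_eq_zero {G : ℕ → Ω → ℝ} (hG : IsGaussianProcess G P)
    (h0 : ∀ k, ∫ ω, G k ω ∂P = 0) (k : ℕ) : ∫ ω, (G (k + 1) ω - G k ω) ∂P = 0 := by
  rw [integral_sub (hG.hasGaussianLaw_eval _).integrable (hG.hasGaussianLaw_eval _).integrable,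
    h0, h0, sub_zero]

/-- The covariance function of fractional Gaussian noise, the increment process of fractional
Brownian motion over intervals of unit length, at the lag `x`. -/
noncomputable def fgnCov (H x : ℝ) : ℝ :=
  (1 / 2) * (|x + 1| ^ (2 * H) - 2 * |x| ^ (2 * H) + |x - 1| ^ (2 * H))

lemma fgnCov_neg (H x : ℝ) : fgnCov H (-x) = fgnCov H x := by
  unfold fgnCov
  rw [show -x + 1 = -(x - 1) by ring, show -x - 1 = -(x + 1) by ring, abs_neg, abs_neg, abs_neg]
  ring

lemma tendsto_rpow_add_one_sub_rpow {p : ℝ} (hp0 : 0 < p) (hp1 : p < 1) :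
    Tendsto (fun x : ℝ => (x + 1) ^ p - x ^ p) atTop (𝓝 0) := by
  -- By Bernoulli's inequality, `(x + 1) ^ p - x ^ p ≤ p x ^ (p - 1)`.
  have hlim : Tendsto (fun x : ℝ => p * x ^ (-(1 - p))) atTop (𝓝 0) := by
    simpa using (tendsto_rpow_neg_atTop (by linarith : 0 < 1 - p)).const_mul p
  refine tendsto_of_tendsto_of_tendsto_of_le_of_le' tendsto_const_nhds hlim ?_ ?_
  · filter_upwards [eventually_gt_atTop 0] with x hx
    exact sub_nonneg.2 (Real.rpow_le_rpow hx.le (by linarith) hp0.le)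
  · filter_upwards [eventually_gt_atTop 0] with x hx
    have hb : (1 + 1 / x) ^ p ≤ 1 + p * (1 / x) :=
      rpow_one_add_le_one_add_mul_self (by have := one_div_pos.2 hx; linarith) hp0.le hp1.le
    have hfac : (x + 1) ^ p = x ^ p * (1 + 1 / x) ^ p := by
      rw [← Real.mul_rpow hx.le (by positivity)]
      congr 1; field_simp
    have hxp : 0 < x ^ p := Real.rpow_pos_of_pos hx p
    have hpow : x ^ (-(1 - p)) = x ^ p * (1 / x) := by
      rw [show -(1 - p) = p - 1 by ring, Real.rpow_sub_one hx.ne']; ring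
    rw [hfac, hpow]
    nlinarith

lemma tendsto_fgnCov {H : ℝ} (hH₀ : 0 < H) (hH₁ : H < 1 / 2) :
    Tendsto (fgnCov H) atTop (𝓝 0) := by
  have h1 := tendsto_rpow_add_one_sub_rpow (p := 2 * H) (by linarith) (by linarith)
  have h2 := h1.comp (tendsto_atTop_add_const_right atTop (-1 : ℝ) tendsto_id)
  have h3 := ((h1.sub h2).const_mul (1 / 2))
  simp only [sub_zero, mul_zero] at h3
  refine h3.congr' ?_
  filter_upwards [eventually_ge_atTop 1] with x hx
  simp only [Function.comp, id, fgnCov]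
  rw [abs_of_nonneg (by linarith : 0 ≤ x + 1), abs_of_nonneg (by linarith : 0 ≤ x),
    abs_of_nonneg (by linarith : 0 ≤ x - 1), show x + -1 + 1 = x by ring,
    show x + -1 = x - 1 by ring]
  ring

variable {B : ℝ≥0 → Ω → ℝ} {H : ℝ} {T : ℝ≥0}

/-- Fractional Brownian motion sampled on the grid of mesh `T / n` and rescaled to unit mesh
by self-similarity. -/
noncomputable def gridProcess (B : ℝ≥0 → Ω → ℝ) (H : ℝ) (T : ℝ≥0) (n k : ℕ) (ω : Ω) : ℝ :=
  ((n : ℝ) / T) ^ H * B (gridPoint T n k) ω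

lemma isGaussianProcess_gridProcess (hB : IsFractionalBrownianMotion B H P) (n : ℕ) :
    IsGaussianProcess (gridProcess B H T n) P :=
  (hB.gaussian.comp_right (gridPoint T n)).smul fun _ => ((n : ℝ) / T) ^ H

lemma integral_gridProcess (hB : IsFractionalBrownianMotion B H P) (n k : ℕ) :
    ∫ ω, gridProcess B H T n k ω ∂P = 0 := by
  unfold gridProcess
  rw [integral_const_mul, hB.centered, mul_zero]

lemma coe_gridPoint (T : ℝ≥0) (n k : ℕ) : (gridPoint T n k : ℝ) = k * (T / n) := by
  simp [gridPoint, mul_div_assoc]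

/-- Self-similarity: the rescaled samples have the covariance of fractional Brownian motion at
integer times, whatever the mesh. -/
lemma integral_gridProcess_mul (hB : IsFractionalBrownianMotion B H P) (hT : 0 < T) {n : ℕ}
    (hn : 0 < n) (j k : ℕ) :
    ∫ ω, gridProcess B H T n j ω * gridProcess B H T n k ω ∂P
      = (1 / 2) * ((j : ℝ) ^ (2 * H) + (k : ℝ) ^ (2 * H) - |(k : ℝ) - j| ^ (2 * H)) := by
  have hn' : (0 : ℝ) < n := by exact_mod_cast hn
  have hT' : (0 : ℝ) < T := hT
  have hd : (0 : ℝ) < T / n := by positivity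
  have h1 : ∀ ω, gridProcess B H T n j ω * gridProcess B H T n k ω
      = ((n : ℝ) / T) ^ (2 * H) * (B (gridPoint T n j) ω * B (gridPoint T n k) ω) := by
    intro ω
    unfold gridProcess
    rw [two_mul, Real.rpow_add (by positivity)]
    ring
  simp_rw [h1]
  have h2 : ((n : ℝ) / T) ^ (2 * H) * ((T : ℝ) / n) ^ (2 * H) = 1 := by
    rw [← Real.mul_rpow (by positivity) (by positivity), div_mul_div_comm, mul_comm (n : ℝ),
      div_self (by positivity), Real.one_rpow]
  rw [integral_const_mul, hB.covariance, coe_gridPoint, coe_gridPoint, ← sub_mul, abs_mul,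
    abs_of_pos hd, Real.mul_rpow (by positivity) hd.le, Real.mul_rpow (by positivity) hd.le,
    Real.mul_rpow (by positivity) hd.le, abs_sub_comm]
  linear_combination (1 / 2 * ((j : ℝ) ^ (2 * H) + (k : ℝ) ^ (2 * H) - |(k : ℝ) - j| ^ (2 * H)))
    * h2

lemma integral_gridIncrement_mul (hB : IsFractionalBrownianMotion B H P) (hT : 0 < T) {n : ℕ}
    (hn : 0 < n) (i j : ℕ) :
    ∫ ω, (gridProcess B H T n (i + 1) ω - gridProcess B H T n i ω)
      * (gridProcess B H T n (j + 1) ω - gridProcess B H T n j ω) ∂P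
      = fgnCov H ((j : ℝ) - i) := by
  rw [integral_increment_mul_increment (isGaussianProcess_gridProcess hB n)]
  simp only [integral_gridProcess_mul hB hT hn, fgnCov]
  push_cast
  rw [show (j : ℝ) + 1 - (i + 1) = j - i by ring, show (j : ℝ) - (i + 1) = j - i - 1 by ring,
    show (j : ℝ) + 1 - i = j - i + 1 by ring]
  ring

lemma integral_gridSecondIncrement_mul (hB : IsFractionalBrownianMotion B H P) (hT : 0 < T)
    {n : ℕ} (hn : 0 < n) (i j : ℕ) :
    ∫ ω, ((gridProcess B H T n (i + 1 + 1) ω - gridProcess B H T n (i + 1) ω)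
        - (gridProcess B H T n (i + 1) ω - gridProcess B H T n i ω))
      * ((gridProcess B H T n (j + 1 + 1) ω - gridProcess B H T n (j + 1) ω)
        - (gridProcess B H T n (j + 1) ω - gridProcess B H T n j ω)) ∂P
      = 2 * fgnCov H ((j : ℝ) - i) - fgnCov H ((j : ℝ) - i + 1) - fgnCov H ((j : ℝ) - i - 1) := by
  rw [integral_increment_mul_increment
    (isGaussianProcess_increment (isGaussianProcess_gridProcess hB n))]
  simp only [integral_gridIncrement_mul hB hT hn]
  push_cast
  rw [show (j : ℝ) + 1 - (i + 1) = j - i by ring, show (j : ℝ) - (i + 1) = j - i - 1 by ring,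
    show (j : ℝ) + 1 - i = j - i + 1 by ring]
  ring

/-- The factor `(n / T) ^ (2H) / n` which normalizes the quadratic variations of fractional Brownian
motion: an increment over a grid interval has variance `(T / n) ^ (2H)`, and there are `n` of
them. -/
noncomputable def variationScale (H : ℝ) (T : ℝ≥0) (n : ℕ) : ℝ := ((n : ℝ) / T) ^ (2 * H) / n

lemma sq_rpow_div (H : ℝ) (T : ℝ≥0) (n : ℕ) :
    (((n : ℝ) / T) ^ H) ^ 2 = ((n : ℝ) / T) ^ (2 * H) := by
  rw [mul_comm, Real.rpow_mul (by positivity)]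
  norm_num

theorem tendstoInMeasure_variationScale_mul_V₁ (hB : IsFractionalBrownianMotion B H P)
    (hH₀ : 0 < H) (hH₁ : H < 1 / 2) (hT : 0 < T) :
    TendstoInMeasure P (fun n ω => variationScale H T n * V₁ T n fun t => B t ω) atTop
      (fun _ => 1) := by
  have h := tendstoInMeasure_average_sq (P := P)
    (fun n => isGaussianProcess_increment (isGaussianProcess_gridProcess (T := T) hB n))
    (fun n k => integral_increment_eq_zero (isGaussianProcess_gridProcess hB n)
      (integral_gridProcess hB n) k) (r := fun k => fgnCov H k)
    ((tendsto_fgnCov hH₀ hH₁).comp tendsto_natCast_atTop_atTop)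
    (fun n hn j k => by rw [integral_gridIncrement_mul hB hT hn]; simp) (N := id)
    (fun _ => le_rfl)
    (tendsto_const_nhds.congr' (by
      filter_upwards [eventually_gt_atTop 0] with n hn
      rw [id, div_self (by positivity)]))
  have hr : fgnCov H ((0 : ℕ) : ℝ) = 1 := by
    simp [fgnCov, Real.zero_rpow (by linarith : 2 * H ≠ 0)]
    norm_num
  rw [hr] at h
  convert h using 3 with n ω
  simp only [V₁, variationScale, gridProcess, id, ← mul_sub, mul_pow, sq_rpow_div]
  rw [← Finset.mul_sum]
  ring

theorem tendstoInMeasure_variationScale_mul_V₂ (hB : IsFractionalBrownianMotion B H P)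
    (hH₀ : 0 < H) (hH₁ : H < 1 / 2) (hT : 0 < T) :
    TendstoInMeasure P (fun n ω => variationScale H T n * V₂ T n fun t => B t ω) atTop
      (fun _ => 4 - 2 ^ (2 * H)) := by
  have hf := tendsto_fgnCov hH₀ hH₁
  have hcov : Tendsto (fun x => 2 * fgnCov H x - fgnCov H (x + 1) - fgnCov H (x - 1)) atTop
      (𝓝 0) := by
    have h1 := hf.comp (tendsto_atTop_add_const_right atTop (1 : ℝ) tendsto_id)
    have h2 := hf.comp (tendsto_atTop_add_const_right atTop (-1 : ℝ) tendsto_id)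
    simpa [Function.comp_def, ← sub_eq_add_neg] using ((hf.const_mul 2).sub h1).sub h2
  have h := tendstoInMeasure_average_sq (P := P)
    (fun n => isGaussianProcess_increment
      (isGaussianProcess_increment (isGaussianProcess_gridProcess (T := T) hB n)))
    (fun n k => integral_increment_eq_zero
      (isGaussianProcess_increment (isGaussianProcess_gridProcess hB n))
      (fun k => integral_increment_eq_zero (isGaussianProcess_gridProcess hB n)
      (integral_gridProcess hB n) k) k)
    (r := fun k => 2 * fgnCov H k - fgnCov H (k + 1) - fgnCov H (k - 1))
    (hcov.comp tendsto_natCast_atTop_atTop)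
    (fun n hn j k => by rw [integral_gridSecondIncrement_mul hB hT hn]; simp) (N := fun n => n - 1)
    (fun _ => Nat.sub_le _ _)
    (by
      have h1 : Tendsto (fun n : ℕ => 1 - ((n : ℝ))⁻¹) atTop (𝓝 1) := by
        simpa using tendsto_inv_atTop_nhds_zero_nat.const_sub (1 : ℝ)
      refine h1.congr' ?_
      filter_upwards [eventually_gt_atTop 0] with n hn
      have hn' : (n : ℝ) ≠ 0 := by positivity
      rw [Nat.cast_sub hn]
      field_simp
      simp)
  have hr : 2 * fgnCov H ((0 : ℕ) : ℝ) - fgnCov H ((0 : ℕ) + 1) - fgnCov H ((0 : ℕ) - 1)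
      = 4 - 2 ^ (2 * H) := by
    have h0 : (0 : ℝ) ^ (2 * H) = 0 := Real.zero_rpow (by linarith)
    rw [Nat.cast_zero, zero_sub, fgnCov_neg, zero_add]
    norm_num [fgnCov, h0]
    ring
  rw [hr] at h
  convert h using 3 with n ω
  simp only [V₂, variationScale, gridProcess, ← mul_sub, mul_pow, sq_rpow_div]
  rw [← Finset.mul_sum, mul_div_assoc, mul_comm_div]
  congr 2
  refine Finset.sum_congr rfl fun k _ => ?_
  rw [show k + 1 + 1 = k + 2 from rfl]
  ring

end RoughBessel

/-! ### Stability of the variations under monotone perturbations -/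

namespace RoughBessel

/-- The reverse triangle inequality for the Euclidean norm. -/
lemma abs_sqrt_sum_sq_sub_sqrt_sum_sq_le (N : ℕ) (f g : ℕ → ℝ) :
    |√(∑ k ∈ Finset.range N, f k ^ 2) - √(∑ k ∈ Finset.range N, g k ^ 2)|
      ≤ √(∑ k ∈ Finset.range N, (f k - g k) ^ 2) := by
  have h : ∀ u : ℕ → ℝ, √(∑ k ∈ Finset.range N, u k ^ 2)
      = ‖WithLp.toLp 2 fun i : Fin N => u i‖ := by
    intro u
    rw [EuclideanSpace.norm_eq, Finset.sum_range]
    simp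
  rw [h, h, h (fun k => f k - g k)]
  exact abs_norm_sub_norm_le (WithLp.toLp 2 fun i : Fin N => f i)
    (WithLp.toLp 2 fun i : Fin N => g i)

section Perturbation

variable {T : ℝ≥0} {n : ℕ} {A x w : ℝ≥0 → ℝ} {x₀ σ : ℝ}

lemma gridPoint_mono (T : ℝ≥0) (n : ℕ) : Monotone (gridPoint T n) := fun j k h => by
  unfold gridPoint; gcongr

lemma sum_sq_gridIncrement_le (hA : Monotone A) (hA0 : A 0 = 0) (hn : 0 < n) :
    ∑ k ∈ Finset.range n, (A (gridPoint T n (k + 1)) - A (gridPoint T n k)) ^ 2 ≤ A T ^ 2 := by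
  have hn' : (n : ℝ≥0) ≠ 0 := by exact_mod_cast hn.ne'
  have hsum : ∑ k ∈ Finset.range n, (A (gridPoint T n (k + 1)) - A (gridPoint T n k)) = A T := by
    rw [Finset.sum_range_sub (fun k => A (gridPoint T n k))]
    simp [gridPoint, hA0, mul_div_cancel_left₀ T hn']
  calc _ ≤ (∑ k ∈ Finset.range n, (A (gridPoint T n (k + 1)) - A (gridPoint T n k))) ^ 2 :=
        Finset.sum_sq_le_sq_sum_of_nonneg fun k _ =>
          sub_nonneg.2 (hA (gridPoint_mono T n k.le_succ))
    _ = A T ^ 2 := by rw [hsum]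

/-- The second differences of `A` are differences of nonnegative increments `u`, `v`, for which
`(u - v) ^ 2 ≤ u ^ 2 + v ^ 2`. -/
lemma sum_sq_gridSecondIncrement_le (hA : Monotone A) (hA0 : A 0 = 0) (hn : 0 < n) :
    ∑ k ∈ Finset.range (n - 1), (A (gridPoint T n (k + 2)) - 2 * A (gridPoint T n (k + 1))
      + A (gridPoint T n k)) ^ 2 ≤ 2 * A T ^ 2 := by
  obtain ⟨m, rfl⟩ : ∃ m, n = m + 1 := ⟨n - 1, by omega⟩
  have h := sum_sq_gridIncrement_le (T := T) hA hA0 hn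
  set b : ℕ → ℝ := fun k => A (gridPoint T (m + 1) (k + 1)) - A (gridPoint T (m + 1) k) with hb
  have hbnn : ∀ k, 0 ≤ b k := fun k => sub_nonneg.2 (hA (gridPoint_mono T _ k.le_succ))
  have h1 : ∑ k ∈ Finset.range m, b k ^ 2 ≤ A T ^ 2 := by
    rw [Finset.sum_range_succ] at h
    linarith [sq_nonneg (b m)]
  have h2 : ∑ k ∈ Finset.range m, b (k + 1) ^ 2 ≤ A T ^ 2 := by
    rw [Finset.sum_range_succ'] at h
    linarith [sq_nonneg (b 0)]
  calc _ ≤ ∑ k ∈ Finset.range m, (b (k + 1) ^ 2 + b k ^ 2) := by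
        refine Finset.sum_le_sum fun k _ => ?_
        have heq : A (gridPoint T (m + 1) (k + 2)) - 2 * A (gridPoint T (m + 1) (k + 1))
            + A (gridPoint T (m + 1) k) = b (k + 1) - b k := by simp only [hb]; ring
        rw [heq]
        nlinarith [mul_nonneg (hbnn k) (hbnn (k + 1))]
    _ ≤ 2 * A T ^ 2 := by rw [Finset.sum_add_distrib]; linarith

lemma abs_sqrt_V₁_sub_le (hA : Monotone A) (hA0 : A 0 = 0)
    (hx : ∀ t, x t = x₀ + A t + σ * w t) (hσ : 0 ≤ σ) (hn : 0 < n) :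
    |√(V₁ T n x) - σ * √(V₁ T n w)| ≤ A T := by
  have hAT : 0 ≤ A T := hA0 ▸ hA zero_le
  have h := abs_sqrt_sum_sq_sub_sqrt_sum_sq_le n
    (fun k => x (gridPoint T n (k + 1)) - x (gridPoint T n k))
    (fun k => σ * (w (gridPoint T n (k + 1)) - w (gridPoint T n k)))
  have h2 : ∑ k ∈ Finset.range n, (x (gridPoint T n (k + 1)) - x (gridPoint T n k)
      - σ * (w (gridPoint T n (k + 1)) - w (gridPoint T n k))) ^ 2 ≤ A T ^ 2 := by
    refine (Finset.sum_le_sum fun k _ => le_of_eq ?_).trans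
      (sum_sq_gridIncrement_le (T := T) hA hA0 hn)
    rw [hx, hx]; ring
  simp_rw [mul_pow] at h
  rw [← Finset.mul_sum, Real.sqrt_mul (sq_nonneg σ), Real.sqrt_sq hσ] at h
  exact h.trans ((Real.sqrt_le_sqrt h2).trans_eq (Real.sqrt_sq hAT))

lemma abs_sqrt_V₂_sub_le (hA : Monotone A) (hA0 : A 0 = 0)
    (hx : ∀ t, x t = x₀ + A t + σ * w t) (hσ : 0 ≤ σ) (hn : 0 < n) :
    |√(V₂ T n x) - σ * √(V₂ T n w)| ≤ 2 * A T := by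
  have hAT : 0 ≤ A T := hA0 ▸ hA zero_le
  have h := abs_sqrt_sum_sq_sub_sqrt_sum_sq_le (n - 1)
    (fun k => x (gridPoint T n (k + 2)) - 2 * x (gridPoint T n (k + 1)) + x (gridPoint T n k))
    (fun k => σ * (w (gridPoint T n (k + 2)) - 2 * w (gridPoint T n (k + 1))
      + w (gridPoint T n k)))
  have h2 : ∑ k ∈ Finset.range (n - 1),
      (x (gridPoint T n (k + 2)) - 2 * x (gridPoint T n (k + 1)) + x (gridPoint T n k)
      - σ * (w (gridPoint T n (k + 2)) - 2 * w (gridPoint T n (k + 1)) + w (gridPoint T n k))) ^ 2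
      ≤ (2 * A T) ^ 2 := by
    refine (Finset.sum_le_sum fun k _ => le_of_eq ?_).trans
      ((sum_sq_gridSecondIncrement_le (T := T) hA hA0 hn).trans (by nlinarith))
    rw [hx, hx, hx]; ring
  simp_rw [mul_pow σ] at h
  rw [← Finset.mul_sum, Real.sqrt_mul (sq_nonneg σ), Real.sqrt_sq hσ] at h
  exact h.trans ((Real.sqrt_le_sqrt h2).trans_eq (Real.sqrt_sq (by positivity)))

end Perturbation

variable {Ω : Type*} [MeasurableSpace Ω] {P : Measure Ω}

lemma tendstoInMeasure_comp_of_continuousAt {E F : Type*} [PseudoMetricSpace E]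
    [PseudoMetricSpace F] {U : ℕ → Ω → E} {u : E}
    (hU : TendstoInMeasure P U atTop fun _ => u) {φ : E → F} (hφ : ContinuousAt φ u) :
    TendstoInMeasure P (fun n ω => φ (U n ω)) atTop fun _ => φ u := by
  refine tendstoInMeasure_of_forall_exists (f := fun n ω => φ (U n ω)) (c := φ u) hU fun δ hδ => ?_
  obtain ⟨η, hη, h⟩ := Metric.continuousAt_iff.1 hφ δ hδ
  exact ⟨η, hη, Eventually.of_forall fun _ => ae_of_all _ fun _ hω => h hω⟩

lemma tendstoInMeasure_of_abs_sub_le {U R f : ℕ → Ω → ℝ} {c : ℝ}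
    (hU : TendstoInMeasure P U atTop fun _ => c) (hR : TendstoInMeasure P R atTop fun _ => 0)
    (h : ∀ᶠ n in atTop, ∀ᵐ ω ∂P, |f n ω - U n ω| ≤ R n ω) :
    TendstoInMeasure P f atTop fun _ => c := by
  have hUR := tendstoInMeasure_prodMk hU hR
  refine tendstoInMeasure_of_forall_exists (f := f) (c := c) hUR fun δ hδ =>
    ⟨δ / 2, by positivity, ?_⟩
  filter_upwards [h] with n hn
  filter_upwards [hn] with ω hω hd
  obtain ⟨h1, h2⟩ := max_lt_iff.1 (Prod.dist_eq (α := ℝ) (β := ℝ) ▸ hd)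
  simp only [Real.dist_eq, sub_zero] at h1 h2 ⊢
  have h3 := le_abs_self (R n ω)
  have h4 := abs_sub_le (f n ω) (U n ω) c
  linarith

/-- A process with almost surely continuous paths is bounded on a compact interval by a finite
random variable. The latter is measurable, being a supremum over a countable dense set. -/
lemma exists_aemeasurable_forall_abs_le {B : ℝ≥0 → Ω → ℝ} (hB : ∀ t, AEMeasurable (B t) P)
    (hBc : ∀ᵐ ω ∂P, Continuous fun t => B t ω) (T : ℝ≥0) :
    ∃ S : Ω → ℝ, AEMeasurable S P ∧ (∀ ω, 0 ≤ S ω) ∧ ∀ᵐ ω ∂P, ∀ t ≤ T, |B t ω| ≤ S ω := by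
  let d : ℕ → ℝ≥0 := TopologicalSpace.denseSeq ℝ≥0
  let S : Ω → ENNReal := fun ω => ⨆ i, ‖B (min (d i) T) ω‖ₑ
  refine ⟨fun ω => (S ω).toReal, ?_, fun ω => ENNReal.toReal_nonneg, ?_⟩
  · exact (AEMeasurable.iSup fun i => (hB _).enorm).ennreal_toReal
  · filter_upwards [hBc] with ω hω
    obtain ⟨M, hM⟩ := (isCompact_Icc (a := 0) (b := T)).bddAbove_image
      (f := fun s => |B s ω|) (by fun_prop)
    have hle : ∀ i, ‖B (min (d i) T) ω‖ₑ ≤ ENNReal.ofReal M := by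
      intro i
      rw [Real.enorm_eq_ofReal_abs]
      exact ENNReal.ofReal_le_ofReal (hM ⟨min (d i) T, ⟨zero_le, min_le_right _ _⟩, rfl⟩)
    have hfin : S ω ≠ ⊤ := ((iSup_le hle).trans_lt ENNReal.ofReal_lt_top).ne
    have hd : ∀ i, |B (min (d i) T) ω| ≤ (S ω).toReal := by
      intro i
      have h : ‖B (min (d i) T) ω‖ₑ ≤ S ω := le_iSup (fun i => ‖B (min (d i) T) ω‖ₑ) i
      have h' := ENNReal.toReal_mono hfin h
      rwa [toReal_enorm, Real.norm_eq_abs] at h'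
    have hcont : Continuous fun t => |B (min t T) ω| :=
      (hω.comp (continuous_id.min continuous_const)).abs
    intro t ht
    have := (TopologicalSpace.denseRange_denseSeq ℝ≥0).induction_on
      (p := fun t => |B (min t T) ω| ≤ (S ω).toReal) t
      (isClosed_le hcont continuous_const) hd
    rwa [min_eq_left ht] at this

variable {H : ℝ} {T : ℝ≥0}

lemma variationScale_pos (H : ℝ) (hT : 0 < T) {n : ℕ} (hn : 0 < n) : 0 < variationScale H T n := by
  have hn' : (0 : ℝ) < n := by exact_mod_cast hn
  have hT' : (0 : ℝ) < T := hT
  unfold variationScale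
  positivity

lemma tendsto_variationScale (hH₁ : H < 1 / 2) (T : ℝ≥0) :
    Tendsto (variationScale H T) atTop (𝓝 0) := by
  have h1 : Tendsto (fun n : ℕ => ((T : ℝ) ^ (2 * H))⁻¹ * (n : ℝ) ^ (-(1 - 2 * H))) atTop
      (𝓝 0) := by
    simpa using ((tendsto_rpow_neg_atTop (by linarith : 0 < 1 - 2 * H)).comp
      tendsto_natCast_atTop_atTop).const_mul ((T : ℝ) ^ (2 * H))⁻¹
  refine h1.congr' ?_
  filter_upwards [eventually_gt_atTop 0] with n hn
  have hn' : (n : ℝ) ≠ 0 := by positivity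
  rw [variationScale, Real.div_rpow (by positivity) (by positivity),
    show -(1 - 2 * H) = 2 * H - 1 by ring, Real.rpow_sub_one hn']
  ring

/-- The estimator, as a function of the normalized square roots of the two variations, is continuous
at their limits, where its value is `H`. -/
lemma continuousAt_log_four_sub_div (hH₀ : 0 < H) (hH₁ : H < 1 / 2) {σ : ℝ} (hσ : 0 < σ) :
    ContinuousAt (fun p : ℝ × ℝ => Real.log (4 - p.2 ^ 2 / p.1 ^ 2) / (2 * Real.log 2))
      (σ * √1, σ * √(4 - 2 ^ (2 * H))) ∧
    Real.log (4 - (σ * √(4 - 2 ^ (2 * H))) ^ 2 / (σ * √1) ^ 2) / (2 * Real.log 2) = H := by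
  have hpow : (2 : ℝ) ^ (2 * H) ≤ 4 := by
    calc (2 : ℝ) ^ (2 * H) ≤ 2 ^ (2 : ℝ) :=
          Real.rpow_le_rpow_of_exponent_le (by norm_num) (by linarith)
      _ = 4 := by norm_num
  have hval : 4 - (σ * √(4 - 2 ^ (2 * H))) ^ 2 / (σ * √1) ^ 2 = (2 : ℝ) ^ (2 * H) := by
    rw [mul_pow, mul_pow, Real.sq_sqrt (by linarith), Real.sqrt_one]
    field_simp
    ring
  have hlog : Real.log 2 ≠ 0 := (Real.log_pos (by norm_num)).ne'
  constructor
  · refine ContinuousAt.div_const (ContinuousAt.log ?_ ?_) _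
    · refine continuousAt_const.sub (ContinuousAt.div (by fun_prop) (by fun_prop) ?_)
      simp [hσ.ne']
    · simp only [hval]
      positivity
  · rw [hval, Real.log_rpow (by norm_num)]
    field_simp

lemma V₁_nonneg (T : ℝ≥0) (n : ℕ) (ξ : ℝ≥0 → ℝ) : 0 ≤ V₁ T n ξ :=
  Finset.sum_nonneg fun _ _ => sq_nonneg _

lemma V₂_nonneg (T : ℝ≥0) (n : ℕ) (ξ : ℝ≥0 → ℝ) : 0 ≤ V₂ T n ξ :=
  Finset.sum_nonneg fun _ _ => sq_nonneg _

lemma hurstEstimator_eq (H : ℝ) (hT : 0 < T) {n : ℕ} (hn : 0 < n) (ξ : ℝ≥0 → ℝ) :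
    hurstEstimator T n ξ = Real.log (4 - (√(variationScale H T n) * √(V₂ T n ξ)) ^ 2
      / (√(variationScale H T n) * √(V₁ T n ξ)) ^ 2) / (2 * Real.log 2) := by
  have hs := variationScale_pos H hT hn
  rw [hurstEstimator, mul_pow, mul_pow, Real.sq_sqrt hs.le, Real.sq_sqrt (V₂_nonneg _ _ _),
    Real.sq_sqrt (V₁_nonneg _ _ _), mul_div_mul_left _ _ hs.ne']

/-- A discrepancy between `√u` and `σ √v` which is bounded in `n` disappears under a normalization
`s n → 0`. -/
lemma tendstoInMeasure_sqrt_variation {s : ℕ → ℝ} (hs : Tendsto s atTop (𝓝 0))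
    (hs0 : ∀ n, 0 ≤ s n) {v u : ℕ → Ω → ℝ} {R : Ω → ℝ} {c σ : ℝ} (hR : AEMeasurable R P)
    [IsFiniteMeasure P]
    (hv : TendstoInMeasure P (fun n ω => s n * v n ω) atTop fun _ => c)
    (h : ∀ᶠ n in atTop, ∀ᵐ ω ∂P, |√(u n ω) - σ * √(v n ω)| ≤ R ω) :
    TendstoInMeasure P (fun n ω => √(s n) * √(u n ω)) atTop fun _ => σ * √c := by
  have hv' := tendstoInMeasure_comp_of_continuousAt hv (φ := fun y => σ * √y) (by fun_prop)
  have hsR : TendstoInMeasure P (fun n ω => √(s n) * R ω) atTop fun _ => 0 := by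
    refine tendstoInMeasure_of_tendsto_ae (fun n => (hR.const_mul _).aestronglyMeasurable)
      (ae_of_all _ fun ω => ?_)
    have := (Real.continuous_sqrt.tendsto 0).comp hs
    simpa using this.mul_const (R ω)
  refine tendstoInMeasure_of_abs_sub_le hv' hsR ?_
  filter_upwards [h] with n hn
  filter_upwards [hn] with ω hω
  rw [Real.sqrt_mul (hs0 n), ← mul_assoc, mul_comm σ, mul_assoc, ← mul_sub, abs_mul,
    abs_of_nonneg (Real.sqrt_nonneg _)]
  exact mul_le_mul_of_nonneg_left hω (Real.sqrt_nonneg _)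

end RoughBessel

/-! ### Consistency of the estimator -/

theorem mainTheorem2 {Ω : Type*} [MeasurableSpace Ω] (P : Measure Ω) [IsProbabilityMeasure P]
    (H x₀ a σ : ℝ) (hH₀ : 0 < H) (hH₁ : H < 1 / 2) (hx₀ : 0 < x₀) (ha : 0 < a) (hσ : 0 < σ)
    (T : ℝ≥0) (hT : 0 < T)
    (B : ℝ≥0 → Ω → ℝ) (hB : RoughBessel.IsFractionalBrownianMotion B H P)
    (hBc : ∀ᵐ ω ∂P, Continuous (fun t => B t ω)) :
    (∀ᵐ ω ∂P,
      (∀ ε : ℝ, 0 < ε →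
        ∃! x : ℝ≥0 → ℝ, RoughBessel.IsPreLimitSolution x₀ a σ ε (fun t => B t ω) x) ∧
      ∀ t : ℝ≥0, Tendsto (fun ε => RoughBessel.preLimit x₀ a σ ε (fun s => B s ω) t)
        (𝓝[>] 0) (𝓝 (RoughBessel.roughBessel x₀ a σ B t ω))) ∧
    TendstoInMeasure P
      (fun (n : ℕ) (ω : Ω) =>
        RoughBessel.hurstEstimator T n (fun t => RoughBessel.roughBessel x₀ a σ B t ω))
      atTop (fun _ => H) := by
  open RoughBessel in
  refine ⟨?_, ?_⟩
  · filter_upwards [hBc] with ω hω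
    exact ⟨fun ε hε => existsUnique_isPreLimitSolution x₀ σ ha hε hω,
      (exists_monotone_besselPath_eq hx₀ ha hσ hω).1⟩
  obtain ⟨S, hSm, hS0, hS⟩ := exists_aemeasurable_forall_abs_le hB.gaussian.aemeasurable hBc T
  -- `R` dominates the total push `A T` by the drift, and is measurable.
  let R : Ω → ℝ := fun ω => σ * S ω + a / x₀ * T
  have hRm : AEMeasurable R P := (hSm.const_mul σ).add_const _
  have hs := tendsto_variationScale hH₁ T
  have hs0 : ∀ n, 0 ≤ variationScale H T n := fun n => by unfold variationScale; positivity
  have h1 : TendstoInMeasure P (fun n ω => √(variationScale H T n) *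
      √(V₁ T n fun t => roughBessel x₀ a σ B t ω)) atTop fun _ => σ * √1 := by
    refine tendstoInMeasure_sqrt_variation hs hs0 hRm
      (tendstoInMeasure_variationScale_mul_V₁ hB hH₀ hH₁ hT) ?_
    filter_upwards [eventually_gt_atTop 0] with n hn
    filter_upwards [hBc, hS] with ω hω hSω
    obtain ⟨-, A, hA, hA0, hx, hAT⟩ := exists_monotone_besselPath_eq hx₀ ha hσ hω
    exact (abs_sqrt_V₁_sub_le hA hA0 hx hσ.le hn).trans (hAT T (S ω) (hS0 ω) hSω)
  have h2 : TendstoInMeasure P (fun n ω => √(variationScale H T n) *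
      √(V₂ T n fun t => roughBessel x₀ a σ B t ω)) atTop fun _ => σ * √(4 - 2 ^ (2 * H)) := by
    refine tendstoInMeasure_sqrt_variation hs hs0 (hRm.const_mul 2)
      (tendstoInMeasure_variationScale_mul_V₂ hB hH₀ hH₁ hT) ?_
    filter_upwards [eventually_gt_atTop 0] with n hn
    filter_upwards [hBc, hS] with ω hω hSω
    obtain ⟨-, A, hA, hA0, hx, hAT⟩ := exists_monotone_besselPath_eq hx₀ ha hσ hω
    exact (abs_sqrt_V₂_sub_le hA hA0 hx hσ.le hn).trans
      (mul_le_mul_of_nonneg_left (hAT T (S ω) (hS0 ω) hSω) (by norm_num))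
  obtain ⟨hcont, hval⟩ := continuousAt_log_four_sub_div hH₀ hH₁ hσ
  have h12 := tendstoInMeasure_prodMk h1 h2
  have h3 := tendstoInMeasure_comp_of_continuousAt h12 hcont
  simp only [hval] at h3
  refine h3.congr' ?_ EventuallyEq.rfl
  filter_upwards [eventually_gt_atTop 0] with n hn
  exact ae_of_all _ fun ω => (hurstEstimator_eq H hT hn _).symm
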